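/- Let $R$ be an associative ring with unit, and work in the category of left $R$-modules. Write $\mathrm{Flat}(R)$ for the class of flat modules and $\mathrm{Inj}(R)$ for the class of injective modules, and set $\mathrm{id}(\mathrm{Flat}(R)) := \sup\{\mathrm{id}(F) : F \in \mathrm{Flat}(R)\}$ and $\mathrm{pd}(\mathrm{Inj}(R)) := \sup\{\mathrm{pd}(I) : I \in \mathrm{Inj}(R)\}$, where $\mathrm{id}$ and $\mathrm{pd}$ denote injective and projective dimension. A module $G$ is Ding projective if it is (isomorphic to) a cycle module of an exact complex $P_\bullet$, indexed by $\mathbb{Z}$, of projective modules such that the complex $\mathrm{Hom}_R(P_\bullet, F)$ is exact for every flat module $F$. The Ding projective dimension of a module $M$ is the smallest $n \ge 0$ for which there is an exact sequence $0 \to G_n \to \cdots \to G_1 \to G_0 \to M \to 0$ with all $G_i$ Ding projective, and $\infty$ if there is no such $n$. The left global Ding projective dimension $\mathrm{gl.DP}(R)$ is the supremum of the Ding projective dimensions of all modules. **Proposition 3.10.** For every ring $R$, $$\mathrm{id}(\mathrm{Flat}(R)) < \infty \ \text{ and } \ \mathrm{pd}(\mathrm{Inj}(R)) < \infty \quad\Longleftrightarrow\quad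 \mathrm{gl.DP}(R) < \infty .$$ -/

import Mathlib

open CategoryTheory CategoryTheory.Limits
open scoped TensorProduct

universe u v w

noncomputable section

namespace RelGorenstein

section Abelian

variable {C : Type u} [Category.{v} C] [Abelian C]

/-- There is an exact sequence `0 → X_n → ⋯ → X_1 → X_0 → M → 0` with all `X_i` in the class `𝒳`.
The sequence is an exact chain complex `K` with `M` in degree `0`, with `X_i` in degree `i + 1`
for `i ≤ n`, and with `0` in all higher degrees. -/
def HasResolutionOfLength (𝒳 : ObjectProperty C) (M : C) (n : ℕ) : Prop :=
  ∃ K : ChainComplex C ℕ, K.Acyclic ∧ Nonempty (K.X 0 ≅ M) ∧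
    (∀ i, i ≤ n → 𝒳 (K.X (i + 1))) ∧ (∀ i, n < i → IsZero (K.X (i + 1)))

/-- The `𝒳`-resolution dimension of `M`: the smallest `n` such that there is an exact sequence
`0 → X_n → ⋯ → X_0 → M → 0` with all `X_i` in `𝒳`, and `∞` if there is no such `n`. -/
def resolutionDimension (𝒳 : ObjectProperty C) (M : C) : ℕ∞ :=
  ⨅ (n : ℕ) (_ : HasResolutionOfLength 𝒳 M n), (n : ℕ∞)

/-- The complex of abelian groups `Hom(K, Y)`. -/
def homComplex (K : ChainComplex C ℤ) (Y : C) :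
    HomologicalComplex AddCommGrpCat.{v} (ComplexShape.down ℤ).symm :=
  ((preadditiveYoneda.obj Y).mapHomologicalComplex _).obj K.op

/-- The class of `(𝒳, 𝒴)`-Gorenstein projective objects: the objects isomorphic to a cycle object
of an exact complex `K` (indexed by `ℤ`) with all terms in `𝒳`, such that the complex `Hom(K, Y)`
is exact for all `Y` in `𝒴`. -/
def gorensteinProjective (𝒳 𝒴 : ObjectProperty C) : ObjectProperty C := fun M =>
  ∃ K : ChainComplex C ℤ, K.Acyclic ∧ (∀ m, 𝒳 (K.X m)) ∧
    (∀ Y, 𝒴 Y → (homComplex K Y).Acyclic) ∧ ∃ m, Nonempty (M ≅ K.cycles m)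

/-- The `(𝒳, 𝒴)`-Gorenstein projective dimension of an object. -/
def gorensteinProjectiveDimension (𝒳 𝒴 : ObjectProperty C) (M : C) : ℕ∞ :=
  resolutionDimension (gorensteinProjective 𝒳 𝒴) M

variable (C) in
/-- The global `(𝒳, 𝒴)`-Gorenstein projective dimension of the category. -/
def globalGorensteinProjectiveDimension (𝒳 𝒴 : ObjectProperty C) : ℕ∞ :=
  ⨆ M : C, gorensteinProjectiveDimension 𝒳 𝒴 M

/-- The projective dimension of a class of objects: the supremum of the projective dimensions
of its members (where the zero object has dimension `⊥`). -/
def classProjectiveDimension (𝒴 : ObjectProperty C) : WithBot ℕ∞ :=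
  ⨆ (Y : C) (_ : 𝒴 Y), projectiveDimension Y

/-- The injective dimension of a class of objects: the supremum of the injective dimensions
of its members (where the zero object has dimension `⊥`). -/
def classInjectiveDimension (𝒴 : ObjectProperty C) : WithBot ℕ∞ :=
  ⨆ (Y : C) (_ : 𝒴 Y), injectiveDimension Y

end Abelian

section Flat

/-! Mathlib has the tensor product and flatness over commutative rings only. Here `R` is an
arbitrary ring; a right `R`-module is a module over `Rᵐᵒᵖ`, with `n r = MulOpposite.op r • n`. -/

variable (R : Type u) [Ring R]

/-- The subgroup of `N ⊗[ℤ] M` generated by the elements `(n r) ⊗ m - n ⊗ (r m)`. -/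
def balancedRelations (N : Type v) [AddCommGroup N] [Module Rᵐᵒᵖ N]
    (M : Type w) [AddCommGroup M] [Module R M] : Submodule ℤ (N ⊗[ℤ] M) :=
  Submodule.span ℤ {t | ∃ (n : N) (r : R) (m : M),
    t = (MulOpposite.op r • n) ⊗ₜ[ℤ] m - n ⊗ₜ[ℤ] (r • m)}

/-- The tensor product `N ⊗_R M` of a right `R`-module `N` and a left `R`-module `M`. -/
abbrev BalancedTensor (N : Type v) [AddCommGroup N] [Module Rᵐᵒᵖ N]
    (M : Type w) [AddCommGroup M] [Module R M] : Type (max v w) :=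
  (N ⊗[ℤ] M) ⧸ balancedRelations R N M

variable {R}

theorem balancedRelations_le_comap {N N' : Type v} [AddCommGroup N] [Module Rᵐᵒᵖ N]
    [AddCommGroup N'] [Module Rᵐᵒᵖ N'] (M : Type w) [AddCommGroup M] [Module R M]
    (f : N →ₗ[Rᵐᵒᵖ] N') :
    balancedRelations R N M ≤
      (balancedRelations R N' M).comap (f.toAddMonoidHom.toIntLinearMap.rTensor M) := by
  refine Submodule.span_le.2 ?_
  rintro _ ⟨n, r, m, rfl⟩
  refine Submodule.subset_span ⟨f n, r, m, ?_⟩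
  simp

/-- The map `f ⊗ M : N ⊗_R M → N' ⊗_R M` induced by a map `f : N → N'` of right `R`-modules. -/
def BalancedTensor.map {N N' : Type v} [AddCommGroup N] [Module Rᵐᵒᵖ N]
    [AddCommGroup N'] [Module Rᵐᵒᵖ N'] (f : N →ₗ[Rᵐᵒᵖ] N')
    (M : Type w) [AddCommGroup M] [Module R M] :
    BalancedTensor R N M →ₗ[ℤ] BalancedTensor R N' M :=
  Submodule.mapQ _ _ (f.toAddMonoidHom.toIntLinearMap.rTensor M)
    (balancedRelations_le_comap M f)

/-- A left `R`-module `M` is flat if tensoring with `M` preserves injectivity of maps of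
right `R`-modules. -/
def IsFlatModule (R : Type u) [Ring R] (M : Type w) [AddCommGroup M] [Module R M] : Prop :=
  ∀ (N N' : Type u) [AddCommGroup N] [Module Rᵐᵒᵖ N] [AddCommGroup N'] [Module Rᵐᵒᵖ N']
    (f : N →ₗ[Rᵐᵒᵖ] N'), Function.Injective f → Function.Injective (BalancedTensor.map f M)

end Flat

section Classes

variable (R : Type u) [Ring R]

/-- The class of projective left `R`-modules. -/
def projClass : ObjectProperty (ModuleCat.{u} R) := fun M => Module.Projective R M

/-- The class of injective left `R`-modules. -/
def injClass : ObjectProperty (ModuleCat.{u} R) := fun M => Module.Injective R M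

/-- The class of flat left `R`-modules. -/
def flatClass : ObjectProperty (ModuleCat.{u} R) := fun M => IsFlatModule R M

/-- The left global Ding projective dimension of `R`: the Ding projective left `R`-modules are the
`(Proj, Flat)`-Gorenstein projective ones. -/
def globalDingProjectiveDimension : ℕ∞ :=
  globalGorensteinProjectiveDimension (ModuleCat.{u} R) (projClass R) (flatClass R)

end Classes

end RelGorenstein

end

/-! A module is Ding projective exactly when it belongs to a class of modules `M` such that all
positive `Ext M F` with `F` flat vanish and `M` embeds into a projective with cokernel in the class
(`IsGorensteinClass`). Splicing these embeddings with a projective resolution of `M` gives the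
required complex; Hom-exactness is the vanishing of `Ext¹` on its cycles.

If `n` bounds both dimensions, the class of all `n`-th syzygies qualifies. Dimension shifting gives
the vanishing. For the embedding, put `M` into an injective `I`; the horseshoe lemma embeds an
`n`-th syzygy of `M` into one of `I`, which is projective, with an `n`-th syzygy of `I/M` as
cokernel. So every module has Ding projective dimension at most `n`.

Conversely, let all these dimensions be at most `n`. Dimension shifting along a Ding projective
resolution gives `Ext M F i = 0` for all `M`, flat `F` and `i > n`, so `F` has injective dimension
at most `n`. Moreover each `M` embeds into some `L` of projective dimension at most `n`
(`IsResolvedBy.exists_isExtension`); for injective `M` the embedding splits, so `M` inherits the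
bound. Here one needs that projectives are flat. -/

noncomputable section

namespace RelGorenstein

/-! ### Short exact sequences and the snake lemma -/

section ShortExact

variable {C : Type u} [Category.{v} C] [Abelian C]

/-- There is a short exact sequence `0 → A → B → D → 0`. -/
def IsExtension (A B D : C) : Prop :=
  ∃ (f : A ⟶ B) (g : B ⟶ D) (w : f ≫ g = 0), (ShortComplex.mk f g w).ShortExact

theorem isExtension_of_shortExact {S : ShortComplex C} (hS : S.ShortExact) :
    IsExtension S.X₁ S.X₂ S.X₃ :=
  ⟨S.f, S.g, S.zero, hS⟩

theorem IsExtension.of_iso {A B D A' B' D' : C} (h : IsExtension A B D)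
    (a : A ≅ A') (b : B ≅ B') (d : D ≅ D') : IsExtension A' B' D' := by
  obtain ⟨f, g, w, hS⟩ := h
  refine ⟨a.inv ≫ f ≫ b.hom, b.inv ≫ g ≫ d.hom, by simp [reassoc_of% w], ?_⟩
  exact ShortComplex.shortExact_of_iso (ShortComplex.isoMk a b d (by simp) (by simp)) hS

theorem isExtension_id_left (A : C) {Z : C} (hZ : IsZero Z) : IsExtension A A Z :=
  ⟨𝟙 A, 0, by simp, ShortComplex.ShortExact.mk'
    ((ShortComplex.exact_iff_epi _ rfl).2 inferInstance) inferInstance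
    (hZ.epi _)⟩

theorem isExtension_id_right (A : C) {Z : C} (hZ : IsZero Z) : IsExtension Z A A :=
  ⟨0, 𝟙 A, by simp, ShortComplex.ShortExact.mk'
    ((ShortComplex.exact_iff_mono _ rfl).2 inferInstance) (hZ.mono _) inferInstance⟩

theorem shortExact_kernel {A B : C} (g : A ⟶ B) [Epi g] :
    (ShortComplex.mk (kernel.ι g) g (kernel.condition g)).ShortExact :=
  ShortComplex.ShortExact.mk' (ShortComplex.exact_kernel g) inferInstance inferInstance

theorem shortExact_cokernel {A B : C} (f : A ⟶ B) [Mono f] :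
    (ShortComplex.mk f (cokernel.π f) (cokernel.condition f)).ShortExact :=
  ShortComplex.ShortExact.mk' (ShortComplex.exact_cokernel f) inferInstance inferInstance

/-- The snake diagram of a morphism of short exact sequences. -/
def snakeInputOfHom {S T : ShortComplex C} (hS : S.ShortExact) (hT : T.ShortExact) (φ : S ⟶ T) :
    ShortComplex.SnakeInput C where
  L₀ := kernel φ
  L₁ := S
  L₂ := T
  L₃ := cokernel φ
  v₀₁ := kernel.ι φ
  v₁₂ := φ
  v₂₃ := cokernel.π φ
  w₀₂ := kernel.condition φ
  w₁₃ := cokernel.condition φ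
  h₀ := kernelIsKernel φ
  h₃ := cokernelIsCokernel φ
  L₁_exact := hS.exact
  epi_L₁_g := hS.epi_g
  L₂_exact := hT.exact
  mono_L₂_f := hT.mono_f

/-- A morphism of short exact sequences with outer components monic induces a short exact sequence
of cokernels, and its middle component is monic. -/
theorem exists_isExtension_cokernel {S T : ShortComplex C} (hS : S.ShortExact) (hT : T.ShortExact)
    (φ : S ⟶ T) {A D : C} {a : T.X₁ ⟶ A} {d : T.X₃ ⟶ D} {wa : φ.τ₁ ≫ a = 0} {wd : φ.τ₃ ≫ d = 0}
    (ha : (ShortComplex.mk φ.τ₁ a wa).ShortExact) (hd : (ShortComplex.mk φ.τ₃ d wd).ShortExact) :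
    ∃ (B : C) (b : T.X₂ ⟶ B) (wb : φ.τ₂ ≫ b = 0), (ShortComplex.mk φ.τ₂ b wb).ShortExact ∧
      IsExtension A B D := by
  let N := snakeInputOfHom hS hT φ
  have := hS.mono_f
  have := hT.mono_f
  have h₁ : Mono φ.τ₁ := ha.mono_f
  have h₃ : Mono φ.τ₃ := hd.mono_f
  have h₂ : Mono φ.τ₂ := ShortComplex.mono_τ₂_of_exact_of_mono φ hS.exact
  have hz : IsZero N.L₀.X₃ :=
    IsZero.of_mono_eq_zero N.v₀₁.τ₃ ((cancel_mono φ.τ₃).1 (N.w₀₂_τ₃.trans zero_comp.symm))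
  have hf : Mono N.L₃.f := (ShortComplex.exact_iff_mono _ (hz.eq_of_src _ _)).1 N.L₂'_exact
  have : Epi N.L₂.g := hT.epi_g
  refine ⟨N.L₃.X₂, N.v₂₃.τ₂, N.w₁₃_τ₂,
    ShortComplex.ShortExact.mk' N.exact_C₂_down h₂ N.epi_v₂₃_τ₂, ?_⟩
  exact (isExtension_of_shortExact (ShortComplex.ShortExact.mk' N.L₃_exact hf inferInstance)).of_iso
    (N.h₃τ₁.coconePointUniqueUpToIso ha.gIsCokernel) (Iso.refl _)
    (N.h₃τ₃.coconePointUniqueUpToIso hd.gIsCokernel)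

/-- A morphism of short exact sequences with outer components epic induces a short exact sequence
of kernels, and its middle component is epic. -/
theorem exists_isExtension_kernel {S T : ShortComplex C} (hS : S.ShortExact) (hT : T.ShortExact)
    (φ : S ⟶ T) {A D : C} {a : A ⟶ S.X₁} {d : D ⟶ S.X₃} {wa : a ≫ φ.τ₁ = 0} {wd : d ≫ φ.τ₃ = 0}
    (ha : (ShortComplex.mk a φ.τ₁ wa).ShortExact) (hd : (ShortComplex.mk d φ.τ₃ wd).ShortExact) :
    ∃ B : C, IsExtension B S.X₂ T.X₂ ∧ IsExtension A B D := by
  let N := snakeInputOfHom hS hT φ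
  have := hS.epi_g
  have := hT.epi_g
  have h₁ : Epi φ.τ₁ := ha.epi_g
  have h₃ : Epi φ.τ₃ := hd.epi_g
  have h₂ : Epi φ.τ₂ := ShortComplex.epi_τ₂_of_exact_of_epi φ hT.exact
  have hz : IsZero N.L₃.X₁ :=
    IsZero.of_epi_eq_zero N.v₂₃.τ₁ ((cancel_epi φ.τ₁).1 (N.w₁₃_τ₁.trans comp_zero.symm))
  have hg : Epi N.L₀.g := (ShortComplex.exact_iff_epi _ (hz.eq_of_tgt _ _)).1 N.L₁'_exact
  have : Mono N.L₁.f := hS.mono_f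
  refine ⟨N.L₀.X₂, ⟨N.v₀₁.τ₂, φ.τ₂, N.w₀₂_τ₂,
    ShortComplex.ShortExact.mk' N.exact_C₂_up N.mono_v₀₁_τ₂ h₂⟩, ?_⟩
  exact (isExtension_of_shortExact (ShortComplex.ShortExact.mk' N.L₀_exact inferInstance hg)).of_iso
    (N.h₀τ₁.conePointUniqueUpToIso ha.fIsKernel) (Iso.refl _)
    (N.h₀τ₃.conePointUniqueUpToIso hd.fIsKernel)

end ShortExact

/-! ### Vanishing of Ext along short exact sequences -/

section ExtVanishing

open Abelian

variable {C : Type u} [Category.{v} C] [Abelian C] [HasExt.{w} C]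

theorem subsingleton_ext_X₂ {S : ShortComplex C} (hS : S.ShortExact) {Y : C} {n : ℕ}
    (h₁ : Subsingleton (Ext S.X₁ Y n)) (h₃ : Subsingleton (Ext S.X₃ Y n)) :
    Subsingleton (Ext S.X₂ Y n) := by
  refine subsingleton_of_forall_eq 0 fun x => ?_
  obtain ⟨y, rfl⟩ := Ext.contravariant_sequence_exact₂ hS Y x (Subsingleton.elim _ _)
  simp [Subsingleton.elim y 0]

theorem subsingleton_ext_X₁ {S : ShortComplex C} (hS : S.ShortExact) {Y : C} {n : ℕ}
    (h₂ : Subsingleton (Ext S.X₂ Y n)) (h₃ : Subsingleton (Ext S.X₃ Y (n + 1))) :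
    Subsingleton (Ext S.X₁ Y n) := by
  refine subsingleton_of_forall_eq 0 fun x => ?_
  obtain ⟨y, rfl⟩ := Ext.contravariant_sequence_exact₁ hS Y x (n₁ := n + 1) (by omega)
    (Subsingleton.elim _ _)
  simp [Subsingleton.elim y 0]

theorem subsingleton_ext_X₃ {S : ShortComplex C} (hS : S.ShortExact) {Y : C} {n : ℕ}
    (h₁ : Subsingleton (Ext S.X₁ Y n)) (h₂ : Subsingleton (Ext S.X₂ Y (n + 1))) :
    Subsingleton (Ext S.X₃ Y (n + 1)) := by
  refine subsingleton_of_forall_eq 0 fun x => ?_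
  obtain ⟨y, rfl⟩ := Ext.contravariant_sequence_exact₃ hS Y x (n₀ := n)
    (Subsingleton.elim _ _) (by omega)
  simp [Subsingleton.elim y 0]

theorem subsingleton_ext_of_iso {A B Y : C} (e : A ≅ B) {n : ℕ}
    (h : Subsingleton (Ext A Y n)) : Subsingleton (Ext B Y n) := by
  refine subsingleton_of_forall_eq 0 fun x => ?_
  have : x = (Ext.mk₀ e.inv).comp ((Ext.mk₀ e.hom).comp x (zero_add n)) (zero_add n) := by
    simp
  rw [this, Subsingleton.elim ((Ext.mk₀ e.hom).comp x (zero_add n)) 0, Ext.comp_zero]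

theorem subsingleton_ext_of_projective (P Y : C) [Projective P] (n : ℕ) :
    Subsingleton (Ext P Y (n + 1)) :=
  HasProjectiveDimensionLT.subsingleton P 1 (n + 1) (by omega) Y

theorem exists_extension_of_subsingleton_ext {S : ShortComplex C} (hS : S.ShortExact) {Y : C}
    (h₃ : Subsingleton (Ext S.X₃ Y 1)) (x : S.X₁ ⟶ Y) : ∃ y : S.X₂ ⟶ Y, S.f ≫ y = x := by
  obtain ⟨y, hy⟩ := Ext.contravariant_sequence_exact₁ hS Y (Ext.mk₀ x) (n₁ := 1) (by omega)
    (Subsingleton.elim _ _)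
  obtain ⟨y, rfl⟩ := Ext.addEquiv₀.symm.surjective y
  refine ⟨y, (Ext.mk₀_bijective _ _).1 ?_⟩
  simpa using hy

/-- As `Ext¹` of the middle term vanishes, every class in `Ext¹ S.X₃ Y` is the connecting image of a
map `S.X₁ ⟶ Y`; that image is zero once the map extends to `S.X₂`. -/
theorem subsingleton_ext_one_of_exists_extension {S : ShortComplex C} (hS : S.ShortExact) {Y : C}
    (h₂ : Subsingleton (Ext S.X₂ Y 1)) (h : ∀ x : S.X₁ ⟶ Y, ∃ y : S.X₂ ⟶ Y, S.f ≫ y = x) :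
    Subsingleton (Ext S.X₃ Y 1) := by
  refine subsingleton_of_forall_eq 0 fun x => ?_
  obtain ⟨y, rfl⟩ := Ext.contravariant_sequence_exact₃ hS Y x (n₀ := 0)
    (Subsingleton.elim _ _) (by omega)
  obtain ⟨y, rfl⟩ := Ext.addEquiv₀.symm.surjective y
  obtain ⟨z, rfl⟩ := h y
  have : Ext.addEquiv₀.symm (S.f ≫ z) = (Ext.mk₀ S.f).comp (Ext.mk₀ z) (zero_add 0) := by simp
  rw [this]
  exact hS.extClass_comp_assoc _

end ExtVanishing

/-! ### Exact complexes versus families of short exact sequences -/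

section Splicing

variable {C : Type u} [Category.{v} C] [Abelian C]

/-- Exactness sees only the image of the first map and the kernel of the second; composing with `p`
and `i` changes neither. -/
theorem exact_of_epi_of_mono {Z₂ Z₁ X₂ X₁ X₀ : C} {f : Z₂ ⟶ X₁} {g : X₁ ⟶ Z₁} {w : f ≫ g = 0}
    (h : (ShortComplex.mk f g w).Exact) (p : X₂ ⟶ Z₂) [Epi p] (i : Z₁ ⟶ X₀) [Mono i]
    (w' : (p ≫ f) ≫ g ≫ i = 0) : (ShortComplex.mk (p ≫ f) (g ≫ i) w').Exact := by
  have w₁ : (p ≫ f) ≫ g = 0 := by simp [w]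
  let φ : ShortComplex.mk (p ≫ f) g w₁ ⟶ ShortComplex.mk f g w :=
    { τ₁ := p, τ₂ := 𝟙 _, τ₃ := 𝟙 _ }
  let ψ : ShortComplex.mk (p ≫ f) g w₁ ⟶ ShortComplex.mk (p ≫ f) (g ≫ i) w' :=
    { τ₁ := 𝟙 _, τ₂ := 𝟙 _, τ₃ := i }
  have : Epi φ.τ₁ := ‹Epi p›
  have : IsIso φ.τ₂ := inferInstanceAs (IsIso (𝟙 _))
  have : Mono φ.τ₃ := inferInstanceAs (Mono (𝟙 _))
  have : Epi ψ.τ₁ := inferInstanceAs (Epi (𝟙 _))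
  have : IsIso ψ.τ₂ := inferInstanceAs (IsIso (𝟙 _))
  have : Mono ψ.τ₃ := ‹Mono i›
  exact (ShortComplex.exact_iff_of_epi_of_isIso_of_mono ψ).1
    ((ShortComplex.exact_iff_of_epi_of_isIso_of_mono φ).2 h)

variable (C) in
/-- Short exact sequences `0 → Z (n + 1) → X (n + 1) → Z n → 0` which can be spliced together to a
chain complex with terms `X n` and cycles `Z n`. -/
structure Splicing (α : Type*) [Add α] [One α] where
  /-- the terms of the complex -/
  X : α → C
  /-- the cycles of the complex -/
  Z : α → C
  /-- the inclusions of the cycles -/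
  i (n : α) : Z n ⟶ X n
  /-- the projections onto the cycles -/
  p (n : α) : X (n + 1) ⟶ Z n
  w (n : α) : i (n + 1) ≫ p n = 0
  shortExact (n : α) : (ShortComplex.mk (i (n + 1)) (p n) (w n)).ShortExact
  mono_i (n : α) : Mono (i n)

namespace Splicing

variable {α : Type*} [AddRightCancelSemigroup α] [One α] (s : Splicing C α)

instance (n : α) : Mono (s.i n) := s.mono_i n

instance (n : α) : Epi (s.p n) := (s.shortExact n).epi_g

theorem d_comp_d (n : α) : (s.p (n + 1) ≫ s.i (n + 1)) ≫ s.p n ≫ s.i n = 0 := by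
  rw [Category.assoc, ← Category.assoc (s.i (n + 1)), s.w, zero_comp, comp_zero]

variable [DecidableEq α]

/-- The chain complex obtained by splicing short exact sequences. -/
abbrev complex : ChainComplex C α :=
  ChainComplex.of s.X (fun n => s.p n ≫ s.i n) s.d_comp_d

theorem complex_d (n : α) : s.complex.d (n + 1) n = s.p n ≫ s.i n :=
  ChainComplex.of_d s.X (fun n => s.p n ≫ s.i n) n

theorem complex_exactAt_succ (n : α) : s.complex.ExactAt (n + 1) := by
  rw [HomologicalComplex.exactAt_iff' _ (n + 1 + 1) (n + 1) n
    (ComplexShape.prev_eq' _ rfl) (ComplexShape.next_eq' _ rfl)]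
  have e : s.complex.sc' (n + 1 + 1) (n + 1) n = ShortComplex.mk _ _ (s.d_comp_d n) := by
    simp only [HomologicalComplex.sc', HomologicalComplex.shortComplexFunctor',
      ChainComplex.of_d]
  rw [e]
  exact exact_of_epi_of_mono (s.shortExact n).exact _ _ _

theorem nonempty_iso_cycles (n : α) : Nonempty (s.Z (n + 1) ≅ s.complex.cycles (n + 1)) := by
  have h := s.complex.cyclesIsKernel (n + 1) n (ComplexShape.next_eq' _ rfl)
  have w : s.i (n + 1) ≫ s.complex.d (n + 1) n = 0 := by
    rw [s.complex_d, ← Category.assoc, s.w, zero_comp]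
  have hk : IsLimit (KernelFork.ofι (s.i (n + 1)) w) := by
    have := (s.shortExact n).fIsKernel
    refine KernelFork.IsLimit.ofι' _ _ fun {A} k hk => ?_
    have hk' : k ≫ s.p n = 0 := by
      rw [← cancel_mono (s.i n), zero_comp, Category.assoc, ← s.complex_d]
      exact hk
    exact KernelFork.IsLimit.lift' this k hk'
  exact ⟨hk.conePointUniqueUpToIso h⟩

end Splicing

theorem acyclic_complex_int (s : Splicing C ℤ) : s.complex.Acyclic := fun n => by
  have := s.complex_exactAt_succ (n - 1)
  rwa [sub_add_cancel] at this

theorem acyclic_complex_nat (s : Splicing C ℕ) [Epi (s.i 0)] : s.complex.Acyclic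
  | n + 1 => s.complex_exactAt_succ n
  | 0 => by
    rw [HomologicalComplex.exactAt_iff' _ 1 0 0 (ComplexShape.prev_eq' _ rfl)
      ChainComplex.next_nat_zero]
    have h0 : (s.complex.sc' 1 0 0).g = 0 := s.complex.shape 0 0 (by simp)
    refine (ShortComplex.exact_iff_epi _ h0).2 ?_
    have : (s.complex.sc' 1 0 0).f = s.p 0 ≫ s.i 0 := s.complex_d 0
    rw [this]
    have : Epi (s.p 0) := (s.shortExact 0).epi_g
    exact epi_comp (s.p 0) (s.i 0)

theorem shortExact_cycles {α : Type*} [AddRightCancelSemigroup α] [One α] {K : ChainComplex C α}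
    {n : α} (hK : K.ExactAt n) :
    (ShortComplex.mk (K.iCycles (n + 1)) (K.toCycles (n + 1) n) (by
      rw [← cancel_mono (K.iCycles n)]; simp)).ShortExact := by
  have hepi : Epi (K.toCycles (n + 1) n) :=
    Preadditive.epi_of_isZero_cokernel' _
      (K.homologyIsCokernel (n + 1) n (ComplexShape.prev_eq' _ rfl)) hK.isZero_homology
  have w : K.iCycles (n + 1) ≫ K.toCycles (n + 1) n = 0 := by
    rw [← cancel_mono (K.iCycles n)]; simp
  have h := K.cyclesIsKernel (n + 1) n (ComplexShape.next_eq' _ rfl)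
  have hk : IsLimit (KernelFork.ofι (K.iCycles (n + 1)) w) := by
    refine KernelFork.IsLimit.ofι' _ _ fun {A} k hk => ?_
    refine KernelFork.IsLimit.lift' h k ?_
    rw [← K.toCycles_i, reassoc_of% hk, zero_comp]
  exact ShortComplex.ShortExact.mk' (ShortComplex.exact_of_f_is_kernel _ hk) inferInstance hepi

theorem homComplex_exactAt_iff (K : ChainComplex C ℤ) (Y : C) (n : ℤ) :
    (homComplex K Y).ExactAt (n + 1) ↔ ∀ f : K.X (n + 1) ⟶ Y, K.d (n + 1 + 1) (n + 1) ≫ f = 0 →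
      ∃ g : K.X n ⟶ Y, K.d (n + 1) n ≫ g = f := by
  rw [HomologicalComplex.exactAt_iff' _ n (n + 1) (n + 1 + 1)
    (ComplexShape.prev_eq' _ (by simp)) (ComplexShape.next_eq' _ (by simp)),
    ShortComplex.ab_exact_iff]
  exact Iff.rfl

end Splicing

/-! ### Gorenstein projective objects and their extensions -/

section Gorenstein

open Abelian

variable {C : Type u} [Category.{v} C] [Abelian C]

theorem exists_splicing_int {Z : ℤ → C}
    (hZ : ∀ n, ∃ P : C, Projective P ∧ IsExtension (Z (n + 1)) P (Z n)) :
    ∃ s : Splicing C ℤ, s.Z = Z ∧ ∀ n, Projective (s.X n) := by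
  -- The term `X n` comes from `hZ (n - 1)`. Letting `p` range over all `m` with `m + 1 = n`
  -- confines the transport along `n - 1 + 1 = n` to this step.
  have h : ∀ n : ℤ, ∃ (X : C) (i : Z n ⟶ X) (p : ∀ m, m + 1 = n → (X ⟶ Z m)), Projective X ∧
      ∀ m h, ∃ w : i ≫ p m h = 0, (ShortComplex.mk i (p m h) w).ShortExact := by
    intro n
    obtain ⟨k, rfl⟩ : ∃ k, n = k + 1 := ⟨n - 1, by omega⟩
    obtain ⟨P, hP, f, g, w, hS⟩ := hZ k
    refine ⟨P, f, fun m h => g ≫ eqToHom (congrArg Z (by omega)), hP, fun m h => ?_⟩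
    obtain rfl : m = k := by omega
    simpa using ⟨w, hS⟩
  choose X i p hX hw hS using h
  have hi : ∀ n, Mono (i n) := fun n => (hS n (n - 1) (by omega)).mono_f
  exact ⟨{ X := X, Z := Z, i := i, p := fun n => p (n + 1) n rfl, w := fun n => hw _ _ _,
           shortExact := fun n => hS _ _ _, mono_i := hi }, rfl, hX⟩

variable {𝒳 𝒴 : ObjectProperty C}

theorem gorensteinProjective_of_iso {A B : C} (h : gorensteinProjective 𝒳 𝒴 A) (e : A ≅ B) :
    gorensteinProjective 𝒳 𝒴 B := by
  obtain ⟨K, h₁, h₂, h₃, m, ⟨e'⟩⟩ := h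
  exact ⟨K, h₁, h₂, h₃, m, ⟨e.symm ≪≫ e'⟩⟩

variable [HasExt.{w} C]

/-- `M` is left orthogonal to the class `𝒴`: all groups `Ext M Y n` with `Y` in `𝒴` and `n` positive
vanish. -/
def ExtVanishes (𝒴 : ObjectProperty C) (M : C) : Prop :=
  ∀ Y, 𝒴 Y → ∀ n : ℕ, Subsingleton (Ext M Y (n + 1))

theorem ExtVanishes.of_iso {A B : C} (h : ExtVanishes 𝒴 A) (e : A ≅ B) :
    ExtVanishes 𝒴 B :=
  fun Y hY n => subsingleton_ext_of_iso e (h Y hY n)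

theorem extVanishes_of_projective (P : C) [Projective P] : ExtVanishes 𝒴 P :=
  fun Y _ n => subsingleton_ext_of_projective P Y n

theorem ExtVanishes.extension {A B D : C} (h : IsExtension A B D)
    (hA : ExtVanishes 𝒴 A) (hD : ExtVanishes 𝒴 D) : ExtVanishes 𝒴 B := by
  obtain ⟨f, g, _, hS⟩ := h
  exact fun Y hY n => subsingleton_ext_X₂ hS (hA Y hY n) (hD Y hY n)

theorem ExtVanishes.kernel {A B D : C} (h : IsExtension A B D)
    (hB : ExtVanishes 𝒴 B) (hD : ExtVanishes 𝒴 D) : ExtVanishes 𝒴 A := by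
  obtain ⟨f, g, _, hS⟩ := h
  exact fun Y hY n => subsingleton_ext_X₁ hS (hB Y hY n) (hD Y hY (n + 1))

variable (𝒴) in
/-- A class of objects which are left orthogonal to `𝒴` and can be embedded into projective objects
with cokernels in the class. -/
def IsGorensteinClass (𝒢 : ObjectProperty C) : Prop :=
  ∀ M, 𝒢 M → ExtVanishes 𝒴 M ∧ ∃ P N : C, Projective P ∧ 𝒢 N ∧ IsExtension M P N

/-- An object of a class as in `IsGorensteinClass` is Gorenstein projective. -/
theorem IsGorensteinClass.gorensteinProjective [EnoughProjectives C]
    (h𝒳 : ∀ M, Projective M → 𝒳 M) {𝒢 : ObjectProperty C}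
    (h𝒢 : IsGorensteinClass 𝒴 𝒢) {M : C} (hM : 𝒢 M) : gorensteinProjective 𝒳 𝒴 M := by
  choose P N hP hN hext using fun A : Subtype 𝒢 => (h𝒢 A.1 A.2).2
  let r : ℕ → Subtype 𝒢 := fun n =>
    Nat.rec (motive := fun _ => Subtype 𝒢) ⟨M, hM⟩ (fun _ A => ⟨N A, hN A⟩) n
  let l : ℕ → C := fun n => Nat.rec (motive := fun _ => C) M (fun _ A => kernel (Projective.π A)) n
  have hl : ∀ n, IsExtension (l (n + 1)) (Projective.over (l n)) (l n) := fun n =>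
    ⟨_, _, _, shortExact_kernel (Projective.π (l n))⟩
  have hlv : ∀ n, ExtVanishes 𝒴 (l n) := fun n => by
    induction n with
    | zero => exact (h𝒢 M hM).1
    | succ n ih => exact ExtVanishes.kernel (hl n) (extVanishes_of_projective _) ih
  -- Both halves start at `M`, so the negative half begins with `r 1`. The `l n` need not lie in
  -- `𝒢`; only their Ext vanishing is used.
  let Z : ℤ → C
    | Int.ofNat n => l n
    | Int.negSucc n => (r (n + 1)).1
  have hZv : ∀ n, ExtVanishes 𝒴 (Z n)
    | Int.ofNat n => hlv n
    | Int.negSucc n => (h𝒢 _ (r (n + 1)).2).1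
  have hZ : ∀ n, ∃ P : C, Projective P ∧ IsExtension (Z (n + 1)) P (Z n)
    | Int.ofNat n => ⟨_, inferInstance, hl n⟩
    | Int.negSucc 0 => ⟨_, hP ⟨M, hM⟩, hext ⟨M, hM⟩⟩
    | Int.negSucc (n + 1) => ⟨_, hP (r (n + 1)), hext (r (n + 1))⟩
  obtain ⟨s, hsZ, hsX⟩ := exists_splicing_int hZ
  refine ⟨s.complex, acyclic_complex_int s, fun n => h𝒳 _ (hsX n), fun Y hY n => ?_, -1 + 1, ?_⟩
  · obtain ⟨n, rfl⟩ : ∃ k, n = k + 1 := ⟨n - 1, by omega⟩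
    rw [homComplex_exactAt_iff]
    intro f hf
    obtain ⟨n, rfl⟩ : ∃ k, n = k + 1 := ⟨n - 1, by omega⟩
    -- A cocycle `f` factors through the cycles `Z (n + 1)`, and the factor extends to `X (n + 1)`
    -- because `Ext¹ (Z n) Y = 0`.
    have hf' : s.i (n + 1 + 1) ≫ f = 0 := by
      rw [← cancel_epi (s.p (n + 1 + 1)), comp_zero, ← Category.assoc, ← s.complex_d]
      exact hf
    obtain ⟨g, hg⟩ : ∃ g, s.p (n + 1) ≫ g = f :=
      ⟨(s.shortExact (n + 1)).exact.desc f hf', (s.shortExact (n + 1)).exact.g_desc f hf'⟩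
    obtain ⟨k, hk⟩ := exists_extension_of_subsingleton_ext (s.shortExact n)
      (show Subsingleton (Ext (s.Z n) Y 1) from hsZ ▸ hZv n Y hY 0) g
    refine ⟨k, ?_⟩
    rw [s.complex_d, ← hg, ← hk, Category.assoc]
  · have := s.nonempty_iso_cycles (-1)
    rw [hsZ] at this
    exact this

/-- The Gorenstein projective objects satisfy `IsGorensteinClass`. -/
theorem isGorensteinClass_gorensteinProjective (h𝒳 : ∀ M, 𝒳 M → Projective M) :
    IsGorensteinClass 𝒴 (gorensteinProjective 𝒳 𝒴) := by
  rintro M ⟨K, hK, hX, hY, m, ⟨e⟩⟩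
  have hP : ∀ n, Projective (K.X n) := fun n => h𝒳 _ (hX n)
  have hS := fun n => shortExact_cycles (hK n)
  have key : ∀ Y, 𝒴 Y → ∀ (n : ℕ) (m : ℤ), Subsingleton (Ext (K.cycles m) Y (n + 1)) := by
    intro Y hYY n
    induction n with
    | zero =>
      intro m
      refine subsingleton_ext_one_of_exists_extension (hS m)
        (subsingleton_ext_of_projective _ _ 0) fun x => ?_
      -- Pulled back to degree `m + 2`, `x` is a cocycle of `Hom(K, Y)`, hence `g` composed with the
      -- differential; cancelling the epi onto the cycles shows that `g` extends `x`.
      obtain ⟨g, hg⟩ := (homComplex_exactAt_iff K Y (m + 1)).1 (hY Y hYY _)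
        (K.toCycles (m + 1 + 1) (m + 1) ≫ x) (by simp)
      refine ⟨g, ?_⟩
      have := (hS (m + 1)).epi_g
      dsimp at this x ⊢
      rw [← cancel_epi (K.toCycles (m + 1 + 1) (m + 1)), ← hg, ← Category.assoc, K.toCycles_i]
    | succ n ih =>
      intro m
      exact subsingleton_ext_X₃ (hS m) (ih (m + 1)) (subsingleton_ext_of_projective _ _ _)
  refine ⟨fun Y hYY n => subsingleton_ext_of_iso e.symm (key Y hYY n m), ?_⟩
  obtain ⟨m, rfl⟩ : ∃ k, m = k + 1 := ⟨m - 1, by omega⟩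
  exact ⟨K.X (m + 1), K.cycles m, hP _, ⟨K, hK, hX, hY, m, ⟨Iso.refl _⟩⟩,
    (isExtension_of_shortExact (hS m)).of_iso e.symm (Iso.refl _) (Iso.refl _)⟩

theorem gorensteinProjective_of_projective [EnoughProjectives C] (h𝒳 : ∀ M, Projective M → 𝒳 M)
    (P : C) [Projective P] : gorensteinProjective 𝒳 𝒴 P := by
  refine IsGorensteinClass.gorensteinProjective h𝒳 (𝒢 := fun M => Projective M) ?_ ‹_›
  exact fun M hM => ⟨extVanishes_of_projective M, M, _, hM, by infer_instance,
    isExtension_id_left M (isZero_zero C)⟩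

/-- An embedding of an object and a compatible embedding of a quotient into projective objects
yield an embedding of an extension. -/
theorem exists_isExtension_biprod {A B D P P' Q Q' : C} (h : IsExtension A B D)
    (hD : Subsingleton (Ext D P 1)) (hA : IsExtension A P P') (hQ : IsExtension D Q Q') :
    ∃ E, IsExtension B (P ⊞ Q) E ∧ IsExtension P' E Q' := by
  obtain ⟨f, g, w, hS⟩ := h
  obtain ⟨a, a', wa, ha⟩ := hA
  obtain ⟨d, d', wd, hd⟩ := hQ
  -- Extending `a` to `b : B ⟶ P` is the only obstructed step. With `g ≫ d` as second coordinate, it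
  -- gives a map of extensions with monic ends.
  obtain ⟨b, hb⟩ := exists_extension_of_subsingleton_ext hS hD a
  dsimp at b hb
  let φ : ShortComplex.mk f g w ⟶ ShortComplex.mk (biprod.inl : P ⟶ P ⊞ Q) biprod.snd (by simp) :=
    { τ₁ := a, τ₂ := biprod.lift b (g ≫ d), τ₃ := d,
      comm₁₂ := by
        apply biprod.hom_ext
        · simp [hb]
        · simp [reassoc_of% w] }
  obtain ⟨E, e, we, hE, h'⟩ := exists_isExtension_cokernel hS
    (ShortComplex.Splitting.ofHasBinaryBiproduct P Q).shortExact φ (wa := wa) (wd := wd) ha hd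
  exact ⟨E, ⟨_, _, _, hE⟩, h'⟩

/-- The Gorenstein projective objects are closed under extensions. -/
theorem gorensteinProjective_extension [EnoughProjectives C] (h𝒳 : ∀ M, 𝒳 M ↔ Projective M)
    (h𝒴 : ∀ M, Projective M → 𝒴 M) {A B D : C} (h : IsExtension A B D)
    (hA : gorensteinProjective 𝒳 𝒴 A) (hD : gorensteinProjective 𝒳 𝒴 D) :
    gorensteinProjective 𝒳 𝒴 B := by
  have hG := isGorensteinClass_gorensteinProjective (𝒴 := 𝒴) fun M => (h𝒳 M).1
  -- The extensions of Gorenstein projectives themselves form a suitable class: the cokernel `E`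
  -- found below is again such an extension.
  refine IsGorensteinClass.gorensteinProjective (fun M => (h𝒳 M).2) (𝒢 := fun B =>
    ∃ A D, gorensteinProjective 𝒳 𝒴 A ∧ gorensteinProjective 𝒳 𝒴 D ∧ IsExtension A B D) ?_
    ⟨A, D, hA, hD, h⟩
  rintro B ⟨A, D, hA, hD, h⟩
  obtain ⟨hAv, P, P', hP, hP', hAP⟩ := hG A hA
  obtain ⟨hDv, Q, Q', hQ, hQ', hDQ⟩ := hG D hD
  obtain ⟨E, hE, hE'⟩ := exists_isExtension_biprod h (hDv P (h𝒴 P hP) 0) hAP hDQ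
  exact ⟨hAv.extension h hDv, _, E, inferInstance, ⟨P', Q', hP', hQ', hE'⟩, hE⟩

end Gorenstein

/-! ### Finite resolutions, syzygies and the horseshoe lemma -/

section Resolutions

variable {C : Type u} [Category.{v} C] [Abelian C]

/-- The inductive description of the objects with an `𝒳`-resolution of length `n`. -/
def IsResolvedBy (𝒳 : ObjectProperty C) : ℕ → C → Prop
  | 0, M => 𝒳 M
  | n + 1, M => ∃ L X, 𝒳 X ∧ IsResolvedBy 𝒳 n L ∧ IsExtension L X M

variable {𝒳 : ObjectProperty C}

theorem IsResolvedBy.of_iso (h𝒳 : ∀ ⦃A B : C⦄, (A ≅ B) → 𝒳 A → 𝒳 B) :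
    ∀ {n : ℕ} {A B : C}, (A ≅ B) → IsResolvedBy 𝒳 n A → IsResolvedBy 𝒳 n B
  | 0, _, _, e, h => h𝒳 e h
  | _ + 1, _, _, e, ⟨L, X, hX, hL, h⟩ =>
    ⟨L, X, hX, hL, h.of_iso (Iso.refl _) (Iso.refl _) e⟩

theorem HasResolutionOfLength.isResolvedBy (h𝒳 : ∀ ⦃A B : C⦄, (A ≅ B) → 𝒳 A → 𝒳 B) {M : C} {n : ℕ}
    (h : HasResolutionOfLength 𝒳 M n) : IsResolvedBy 𝒳 n M := by
  obtain ⟨K, hK, ⟨e⟩, hX, hZ⟩ := h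
  have hS := fun j => shortExact_cycles (hK j)
  -- Descending through the degrees: the top cycles are isomorphic to the last term, and each lower
  -- step adds one term.
  have key : ∀ k j, j + k = n → IsResolvedBy 𝒳 k (K.cycles j) := by
    intro k
    induction k with
    | zero =>
      rintro j rfl
      have hz : IsZero (K.cycles (j + 1)) := by
        have := (hS (j + 1)).epi_g
        exact IsZero.of_epi (K.toCycles (j + 1 + 1) (j + 1)) (hZ (j + 1) (by omega))
      have : IsIso (K.toCycles (j + 1) j) := (hS j).isIso_g_iff.2 hz
      exact h𝒳 (asIso (K.toCycles (j + 1) j)) (hX j le_rfl)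
    | succ k ih =>
      intro j hj
      exact ⟨_, _, hX j (by omega), ih (j + 1) (by omega), isExtension_of_shortExact (hS j)⟩
  have : IsIso (K.iCycles 0) := K.isIso_iCycles 0 0 ChainComplex.next_nat_zero
    (K.shape 0 0 (by simp))
  exact (key n 0 (zero_add n)).of_iso h𝒳 (asIso (K.iCycles 0) ≪≫ e)

theorem IsResolvedBy.exists_sequence : ∀ {n : ℕ} {M : C}, IsResolvedBy 𝒳 n M →
    ∃ Z X : ℕ → C, Z 0 = M ∧ (∀ j, IsExtension (Z (j + 1)) (X j) (Z j)) ∧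
      (∀ j, j ≤ n → 𝒳 (X j)) ∧ ∀ j, n < j → IsZero (X j)
  | 0, M, h => by
    have h0 : IsZero (⊥_ C) := (isZero_zero C).of_iso HasZeroObject.zeroIsoInitial.symm
    refine ⟨fun j => Nat.casesOn j M fun _ => ⊥_ C, fun j => Nat.casesOn j M fun _ => ⊥_ C, rfl,
      fun j => ?_, fun j hj => ?_, fun j hj => ?_⟩
    · cases j with
      | zero => exact isExtension_id_right M h0
      | succ j => exact isExtension_id_right _ h0
    · obtain rfl : j = 0 := by omega
      exact h
    · cases j with
      | zero => omega
      | succ j => exact h0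
  | n + 1, M, ⟨L, X, hX, hL, h⟩ => by
    obtain ⟨Z', X', rfl, h₁, h₂, h₃⟩ := hL.exists_sequence
    refine ⟨fun j => Nat.casesOn j M Z', fun j => Nat.casesOn j X X', rfl,
      fun j => ?_, fun j hj => ?_, fun j hj => ?_⟩
    · cases j with
      | zero => exact h
      | succ j => exact h₁ j
    · cases j with
      | zero => exact hX
      | succ j => exact h₂ j (by omega)
    · cases j with
      | zero => omega
      | succ j => exact h₃ j (by omega)

theorem IsResolvedBy.hasResolutionOfLength {M : C} {n : ℕ} (h : IsResolvedBy 𝒳 n M) :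
    HasResolutionOfLength 𝒳 M n := by
  obtain ⟨Z, X, rfl, h₁, h₂, h₃⟩ := h.exists_sequence
  choose f g w hS using h₁
  -- The resolved object sits in degree `0` and equals its own cycles there, hence the shift by one
  -- and `i 0 = 𝟙`.
  let X' : ℕ → C
    | 0 => Z 0
    | j + 1 => X j
  let i : ∀ j, Z j ⟶ X' j
    | 0 => 𝟙 (Z 0)
    | j + 1 => f j
  let s : Splicing C ℕ :=
    { X := X'
      Z := Z
      i := i
      p := g
      w := w
      shortExact := hS
      mono_i := fun j => by
        cases j with
        | zero => exact inferInstanceAs (Mono (𝟙 (Z 0)))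
        | succ j => exact (hS j).mono_f }
  have : Epi (s.i 0) := inferInstanceAs (Epi (𝟙 (Z 0)))
  exact ⟨s.complex, acyclic_complex_nat s, ⟨Iso.refl _⟩, h₂, h₃⟩

/-- The relation that `K` is an `n`-th syzygy of `M`, for some projective resolution of `M`. -/
def IsSyzygy : ℕ → C → C → Prop
  | 0, M, K => Nonempty (K ≅ M)
  | n + 1, M, K => ∃ L P, Projective P ∧ IsExtension L P M ∧ IsSyzygy n L K

theorem exists_isSyzygy [EnoughProjectives C] : ∀ (n : ℕ) (M : C), ∃ K, IsSyzygy n M K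
  | 0, M => ⟨M, ⟨Iso.refl M⟩⟩
  | n + 1, M => by
    obtain ⟨K, hK⟩ := exists_isSyzygy n (kernel (Projective.π M))
    exact ⟨K, _, _, inferInstance, ⟨_, _, _, shortExact_kernel (Projective.π M)⟩, hK⟩

theorem IsSyzygy.isResolvedBy (h𝒳 : ∀ M, Projective M → 𝒳 M)
    (h𝒳' : ∀ ⦃A B : C⦄, (A ≅ B) → 𝒳 A → 𝒳 B) :
    ∀ {n : ℕ} {M K : C}, IsSyzygy n M K → 𝒳 K → IsResolvedBy 𝒳 n M
  | 0, _, _, ⟨e⟩, hK => h𝒳' e hK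
  | _ + 1, _, _, ⟨L, P, hP, h, hL⟩, hK => ⟨L, P, h𝒳 P hP, hL.isResolvedBy h𝒳 h𝒳' hK, h⟩

/-- One step of the horseshoe lemma. -/
theorem exists_isExtension_horseshoe {A B D P Q L N : C} [Projective Q] (h : IsExtension A B D)
    (hA : IsExtension L P A) (hD : IsExtension N Q D) :
    ∃ E, IsExtension E (P ⊞ Q) B ∧ IsExtension L E N := by
  obtain ⟨f, g, w, hS⟩ := h
  obtain ⟨a', a, wa, ha⟩ := hA
  obtain ⟨d', d, wd, hd⟩ := hD
  have hg : Epi g := hS.epi_g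
  let b := Projective.factorThru d g
  let φ : ShortComplex.mk (biprod.inl : P ⟶ P ⊞ Q) biprod.snd (by simp) ⟶ ShortComplex.mk f g w :=
    { τ₁ := a, τ₂ := biprod.desc (a ≫ f) b, τ₃ := d,
      comm₂₃ := by
        apply biprod.hom_ext'
        · simp [w]
        · simp [b] }
  exact exists_isExtension_kernel (ShortComplex.Splitting.ofHasBinaryBiproduct P Q).shortExact hS φ
    (wa := wa) (wd := wd) ha hd

/-- Iterated horseshoe. The syzygy `K` of `A` is prescribed; a resolution of `D` is chosen freely,
and the two determine one of `B`. -/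
theorem IsSyzygy.exists_isExtension [EnoughProjectives C] :
    ∀ {n : ℕ} {A B D K : C}, IsExtension A B D → IsSyzygy n A K →
      ∃ K' K'', IsSyzygy n B K' ∧ IsSyzygy n D K'' ∧ IsExtension K K' K''
  | 0, _, B, D, _, h, ⟨e⟩ =>
    ⟨B, D, ⟨Iso.refl B⟩, ⟨Iso.refl D⟩, h.of_iso e.symm (Iso.refl B) (Iso.refl D)⟩
  | n + 1, A, B, D, K, h, ⟨L, P, hP, hA, hL⟩ => by
    obtain ⟨E, hE, hE'⟩ := exists_isExtension_horseshoe h hA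
      ⟨_, _, _, shortExact_kernel (Projective.π D)⟩
    obtain ⟨K', K'', h₁, h₂, h₃⟩ := hL.exists_isExtension hE'
    exact ⟨K', K'', ⟨E, _, inferInstance, hE, h₁⟩,
      ⟨_, _, inferInstance, ⟨_, _, _, shortExact_kernel (Projective.π D)⟩, h₂⟩, h₃⟩

theorem IsSyzygy.projective : ∀ {n : ℕ} {M K : C}, IsSyzygy n M K →
    HasProjectiveDimensionLT M (n + 1) → Projective K
  | 0, _, _, ⟨e⟩, h => Projective.of_iso e.symm (projective_iff_hasProjectiveDimensionLT_one.2 h)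
  | n + 1, _, _, ⟨_, _, hP, ⟨_, _, _, hS⟩, hL⟩, h =>
    hL.projective ((hS.hasProjectiveDimensionLT_X₃_iff n hP).1 h)

/-- The third isomorphism theorem. -/
theorem isExtension_of_comp {A B D N E F : C} {f : A ⟶ B} {g : B ⟶ D} {p : B ⟶ N} {q : D ⟶ E}
    {wp : f ≫ p = 0} {wq : g ≫ q = 0} (hf : (ShortComplex.mk f p wp).ShortExact)
    (hg : (ShortComplex.mk g q wq).ShortExact) {r : D ⟶ F} {wr : (f ≫ g) ≫ r = 0}
    (hr : (ShortComplex.mk (f ≫ g) r wr).ShortExact) : IsExtension N F E := by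
  -- Map the sequence `A = A → 0` into `B → D → E` by `f`, `f ≫ g` and `0`; the cokernels are `N`,
  -- `F` and `E`.
  let φ : ShortComplex.mk (𝟙 A) (0 : A ⟶ ⊥_ C) (by simp) ⟶ ShortComplex.mk g q wq :=
    { τ₁ := f, τ₂ := f ≫ g, τ₃ := 0, comm₂₃ := by simp [wq] }
  have h0 : IsZero (⊥_ C) := (isZero_zero C).of_iso HasZeroObject.zeroIsoInitial.symm
  have hid : (ShortComplex.mk (𝟙 A) (0 : A ⟶ ⊥_ C) (by simp)).ShortExact :=
    ShortComplex.ShortExact.mk' ((ShortComplex.exact_iff_epi _ rfl).2 inferInstance) inferInstance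
      (h0.epi _)
  have hid' : (ShortComplex.mk (0 : ⊥_ C ⟶ E) (𝟙 E) (by simp)).ShortExact :=
    ShortComplex.ShortExact.mk' ((ShortComplex.exact_iff_mono _ rfl).2 inferInstance)
      (h0.mono _) inferInstance
  obtain ⟨B', b, wb, hb, h⟩ := exists_isExtension_cokernel hid hg φ (wa := wp) (wd := zero_comp)
    hf hid'
  exact h.of_iso (Iso.refl _) (hb.gIsCokernel.coconePointUniqueUpToIso hr.gIsCokernel) (Iso.refl _)

end Resolutions

/-! ### Dimension shifting and approximation by finite projective dimension -/

section Dimension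

open Abelian

variable {C : Type u} [Category.{v} C] [Abelian C] [HasExt.{w} C] {𝒳 𝒴 : ObjectProperty C}

theorem IsSyzygy.subsingleton_ext {Y : C} : ∀ {n : ℕ} {M K : C}, IsSyzygy n M K → ∀ (j : ℕ),
    Subsingleton (Ext M Y (j + 1 + n)) → Subsingleton (Ext K Y (j + 1))
  | 0, _, _, ⟨e⟩, _, h => subsingleton_ext_of_iso e.symm h
  | n + 1, _, _, ⟨_, P, _, ⟨_, _, _, hS⟩, hL⟩, j, h =>
    hL.subsingleton_ext j
      (subsingleton_ext_X₁ hS (by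
        dsimp; rw [show j + 1 + n = j + n + 1 by omega]
        exact subsingleton_ext_of_projective P Y (j + n)) h)

/-- If `𝒴` has injective dimension at most `n` and the injective objects have projective dimension
at most `n`, then `n`-th syzygies are Gorenstein projective. -/
theorem IsSyzygy.gorensteinProjective [EnoughProjectives C] [EnoughInjectives C]
    (h𝒳 : ∀ M, Projective M → 𝒳 M) {n : ℕ} (hY : ∀ Y, 𝒴 Y → HasInjectiveDimensionLT Y (n + 1))
    (hI : ∀ I : C, Injective I → HasProjectiveDimensionLT I (n + 1)) {M K : C}
    (h : IsSyzygy n M K) : gorensteinProjective 𝒳 𝒴 K := by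
  refine IsGorensteinClass.gorensteinProjective h𝒳 (𝒢 := fun K => ∃ M, IsSyzygy n M K) ?_ ⟨M, h⟩
  rintro K ⟨M, h⟩
  refine ⟨fun Y hYY j => h.subsingleton_ext j ?_, ?_⟩
  · have := hY Y hYY
    exact HasInjectiveDimensionLT.subsingleton Y (n + 1) (j + 1 + n) (by omega) M
  · obtain ⟨K', K'', h₁, h₂, h₃⟩ := h.exists_isExtension
      ⟨_, _, _, shortExact_cokernel (Injective.ι M)⟩
    exact ⟨K', K'', h₁.projective (hI _ inferInstance), ⟨_, h₂⟩, h₃⟩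

theorem IsResolvedBy.subsingleton_ext (h𝒳 : ∀ M, 𝒳 M → ExtVanishes 𝒴 M) {Y : C} (hY : 𝒴 Y) :
    ∀ {n : ℕ} {M : C}, IsResolvedBy 𝒳 n M → ∀ j, n < j → Subsingleton (Ext M Y j)
  | 0, M, h, j + 1, _ => h𝒳 M h Y hY j
  | n + 1, M, ⟨L, X, hX, hL, ⟨_, _, _, hS⟩⟩, j + 1, hj =>
    subsingleton_ext_X₃ hS (hL.subsingleton_ext h𝒳 hY j (by omega)) (h𝒳 X hX Y hY j)

/-- Objects of finite Gorenstein projective dimension embed into objects of finite projective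
dimension with Gorenstein projective cokernel. -/
theorem IsResolvedBy.exists_isExtension [EnoughProjectives C] (h𝒳 : ∀ M, 𝒳 M ↔ Projective M)
    (h𝒴 : ∀ M, Projective M → 𝒴 M) : ∀ {n : ℕ} {M : C},
    IsResolvedBy (RelGorenstein.gorensteinProjective 𝒳 𝒴) n M →
      ∃ L G, HasProjectiveDimensionLT L (n + 1) ∧ RelGorenstein.gorensteinProjective 𝒳 𝒴 G ∧
        IsExtension M L G
  | 0, M, h => by
    obtain ⟨-, P, N, hP, hN, h'⟩ := isGorensteinClass_gorensteinProjective (fun M => (h𝒳 M).1) M h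
    exact ⟨P, N, inferInstance, hN, h'⟩
  | n + 1, M, ⟨K, G, hG, hK, ⟨i, p, w, hS⟩⟩ => by
    have hcl := isGorensteinClass_gorensteinProjective (𝒴 := 𝒴) fun M => (h𝒳 M).1
    obtain ⟨L, G', hL, hG', hKL⟩ := hK.exists_isExtension h𝒳 h𝒴
    obtain ⟨hGv, P, G₁, hP, hG₁, j, q, wq, hj⟩ := hcl G hG
    obtain ⟨hG'v, Q, G₂, hQ, hG₂, hQG⟩ := hcl G' hG'
    have := hS.mono_f
    have := hj.mono_f
    dsimp at *
    -- Write `c` for this cokernel of `K ⟶ P`. Then `M = G/K` embeds into `c` with cokernel `G₁`.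
    -- Embedding `L` into `P ⊞ Q` compatibly with `K ⟶ P` gives a quotient `E` that contains `c`
    -- with cokernel `G₂`. Passing from `L` to `E` raises the projective dimension bound by one, and
    -- `E/M` is an extension of `G₂` by `G₁`.
    have hc := shortExact_cokernel (i ≫ j)
    obtain ⟨E, ⟨_, _, _, hE⟩, l, r, wr, hl⟩ := exists_isExtension_biprod hKL (hG'v P (h𝒴 P hP) 0)
      ⟨_, _, _, hc⟩ hQG
    obtain ⟨m, m', wm, hm⟩ := isExtension_of_comp hS hj hc
    have := hm.mono_f
    have := hl.mono_f
    dsimp at *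
    have hE' := hE.hasProjectiveDimensionLT_X₃ (n + 1) hL inferInstance
    refine ⟨E, cokernel (m ≫ l), hE', ?_, ⟨_, _, _, shortExact_cokernel (m ≫ l)⟩⟩
    exact gorensteinProjective_extension h𝒳 h𝒴
      (isExtension_of_comp hm hl (shortExact_cokernel (m ≫ l))) hG₁ hG₂

end Dimension

/-! ### Projective modules over an arbitrary ring are flat -/

section FlatOfProjective

variable {R : Type u} [Ring R]

/-- The map `N ⊗_R M → (M →₀ N)` induced by a map `s : M → (M →₀ R)`. -/
def BalancedTensor.toFinsupp (N : Type v) [AddCommGroup N] [Module Rᵐᵒᵖ N] {M : Type w}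
    [AddCommGroup M] [Module R M] (s : M →ₗ[R] M →₀ R) : BalancedTensor R N M →ₗ[ℤ] M →₀ N :=
  (balancedRelations R N M).liftQ
    (TensorProduct.liftAddHom
      (AddMonoidHom.mk' (fun n => AddMonoidHom.mk'
          (fun m => (s m).mapRange (fun r => MulOpposite.op r • n) (by simp))
          (fun a b => by ext x; simp [add_smul]))
        (fun a b => by ext m x; simp))
      (fun z n m => by
        ext x
        simp only [AddMonoidHom.mk'_apply, Finsupp.mapRange_apply,
          LinearMap.map_smul_of_tower, Finsupp.smul_apply, MulOpposite.op_smul, smul_assoc]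
        exact (smul_comm z (MulOpposite.op (s m x)) n).symm)).toIntLinearMap (by
    refine Submodule.span_le.2 ?_
    rintro _ ⟨n, r, m, rfl⟩
    rw [SetLike.mem_coe, LinearMap.mem_ker]
    ext x
    simp [mul_smul])

theorem BalancedTensor.toFinsupp_mk_tmul {N : Type v} [AddCommGroup N] [Module Rᵐᵒᵖ N] {M : Type w}
    [AddCommGroup M] [Module R M] (s : M →ₗ[R] M →₀ R) (n : N) (m x : M) :
    toFinsupp N s (Submodule.Quotient.mk (n ⊗ₜ m)) x = MulOpposite.op (s m x) • n :=
  rfl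

/-- The map `(M →₀ N) → N ⊗_R M` which sends `single m n` to `n ⊗ m`. -/
def BalancedTensor.ofFinsupp (R : Type u) [Ring R] (N : Type v) [AddCommGroup N] [Module Rᵐᵒᵖ N]
    (M : Type w) [AddCommGroup M] [Module R M] : (M →₀ N) →+ BalancedTensor R N M :=
  Finsupp.liftAddHom fun m =>
    ((balancedRelations R N M).mkQ.toAddMonoidHom).comp
      ((TensorProduct.mk ℤ N M).flip m).toAddMonoidHom

theorem BalancedTensor.mk_op_smul_tmul {N : Type v} [AddCommGroup N] [Module Rᵐᵒᵖ N] {M : Type w}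
    [AddCommGroup M] [Module R M] (n : N) (r : R) (m : M) :
    (Submodule.Quotient.mk ((MulOpposite.op r • n) ⊗ₜ m) : BalancedTensor R N M) =
      Submodule.Quotient.mk (n ⊗ₜ (r • m)) :=
  (Submodule.Quotient.eq _).2 (Submodule.subset_span ⟨n, r, m, rfl⟩)

/-- On generators, `∑ (n · s(m)(x)) ⊗ x = n ⊗ ∑ s(m)(x) x = n ⊗ m`, by balancedness and because `s`
is a section. -/
theorem BalancedTensor.ofFinsupp_toFinsupp {N : Type v} [AddCommGroup N] [Module Rᵐᵒᵖ N]
    {M : Type w} [AddCommGroup M] [Module R M] (s : M →ₗ[R] M →₀ R)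
    (hs : ∀ m, Finsupp.linearCombination R id (s m) = m) (t : BalancedTensor R N M) :
    ofFinsupp R N M (toFinsupp N s t) = t := by
  obtain ⟨t, rfl⟩ := Submodule.Quotient.mk_surjective _ t
  induction t using TensorProduct.induction_on with
  | zero => simp
  | add x y hx hy => rw [Submodule.Quotient.mk_add, map_add, map_add, hx, hy]
  | tmul n m =>
    have h : toFinsupp N s (Submodule.Quotient.mk (n ⊗ₜ m)) =
        (s m).mapRange (fun r => MulOpposite.op r • n) (by simp) := by
      ext x
      simp [toFinsupp_mk_tmul]
    rw [h, ofFinsupp, Finsupp.liftAddHom_apply, Finsupp.sum_mapRange_index (by simp)]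
    simp only [AddMonoidHom.comp_apply, LinearMap.toAddMonoidHom_coe, LinearMap.flip_apply,
      TensorProduct.mk_apply, Submodule.mkQ_apply, mk_op_smul_tmul]
    conv_rhs => rw [← hs m, Finsupp.linearCombination_apply, Finsupp.sum, TensorProduct.tmul_sum]
    exact (map_sum (balancedRelations R N M).mkQ _ _).symm

theorem BalancedTensor.toFinsupp_map {N N' : Type v} [AddCommGroup N] [Module Rᵐᵒᵖ N]
    [AddCommGroup N'] [Module Rᵐᵒᵖ N'] {M : Type w} [AddCommGroup M] [Module R M]
    (s : M →ₗ[R] M →₀ R) (f : N →ₗ[Rᵐᵒᵖ] N') (t : BalancedTensor R N M) (x : M) :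
    toFinsupp N' s (map f M t) x = f (toFinsupp N s t x) := by
  obtain ⟨t, rfl⟩ := Submodule.Quotient.mk_surjective _ t
  induction t using TensorProduct.induction_on with
  | zero => simp
  | add a b ha hb => simp only [Submodule.Quotient.mk_add, map_add, Finsupp.add_apply, ha, hb]
  | tmul n m =>
    have : map f M (Submodule.Quotient.mk (n ⊗ₜ m)) = Submodule.Quotient.mk (f n ⊗ₜ m) := rfl
    rw [this, toFinsupp_mk_tmul, toFinsupp_mk_tmul, map_smul]

/-- A section `s` of the free cover makes `N ⊗_R M` a retract of `M →₀ N`, by an embedding natural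
in `N`; and `M →₀ -` preserves injectivity. -/
theorem isFlatModule_of_projective (M : Type w) [AddCommGroup M] [Module R M]
    [Module.Projective R M] : IsFlatModule R M := by
  obtain ⟨s, hs⟩ := Module.projective_def.1 ‹Module.Projective R M›
  intro N N' _ _ _ _ f hf a b hab
  have h : BalancedTensor.toFinsupp N s a = BalancedTensor.toFinsupp N s b := by
    ext x
    apply hf
    rw [← BalancedTensor.toFinsupp_map, ← BalancedTensor.toFinsupp_map, hab]
  rw [← BalancedTensor.ofFinsupp_toFinsupp s hs a, h, BalancedTensor.ofFinsupp_toFinsupp s hs b]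

end FlatOfProjective

/-! ### Suprema of dimensions as uniform bounds, and the equivalence -/

section GlobalDimension

variable {C : Type u} [Category.{v} C] [Abelian C] {𝒳 𝒴 : ObjectProperty C}

theorem exists_nat_of_lt_top {a : WithBot ℕ∞} (h : a < ⊤) : ∃ n : ℕ, a ≤ (n : ℕ) := by
  induction a with
  -- The supremum is `⊥` when the class has only zero objects; any natural number is then a bound.
  | bot => exact ⟨0, bot_le⟩
  | coe a =>
    lift a to ℕ using fun ha => by simp [ha] at h
    exact ⟨a, le_rfl⟩

theorem classInjectiveDimension_lt_top_iff : classInjectiveDimension 𝒴 < ⊤ ↔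
    ∃ n : ℕ, ∀ Y, 𝒴 Y → HasInjectiveDimensionLT Y (n + 1) := by
  simp only [← injectiveDimension_le_iff]
  constructor
  · intro h
    obtain ⟨n, hn⟩ := exists_nat_of_lt_top h
    exact ⟨n, fun Y hY => (le_iSup₂ (f := fun (Y : C) (_ : 𝒴 Y) => injectiveDimension Y) Y hY).trans
      hn⟩
  · rintro ⟨n, hn⟩
    exact (iSup₂_le hn).trans_lt (WithBot.coe_lt_coe.2 (ENat.natCast_lt_top n))

theorem classProjectiveDimension_lt_top_iff : classProjectiveDimension 𝒴 < ⊤ ↔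
    ∃ n : ℕ, ∀ Y, 𝒴 Y → HasProjectiveDimensionLT Y (n + 1) := by
  simp only [← projectiveDimension_le_iff]
  constructor
  · intro h
    obtain ⟨n, hn⟩ := exists_nat_of_lt_top h
    exact ⟨n, fun Y hY =>
      (le_iSup₂ (f := fun (Y : C) (_ : 𝒴 Y) => projectiveDimension Y) Y hY).trans hn⟩
  · rintro ⟨n, hn⟩
    exact (iSup₂_le hn).trans_lt (WithBot.coe_lt_coe.2 (ENat.natCast_lt_top n))

theorem resolutionDimension_le_iff {M : C} {n : ℕ} :
    resolutionDimension 𝒳 M ≤ n ↔ ∃ k ≤ n, HasResolutionOfLength 𝒳 M k := by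
  constructor
  · intro h
    -- A strict bound on an infimum yields a member below it, hence `n + 1`.
    have h' : resolutionDimension 𝒳 M < ((n + 1 : ℕ) : ℕ∞) :=
      h.trans_lt (by exact_mod_cast Nat.lt_succ_self n)
    simp only [resolutionDimension, iInf_lt_iff] at h'
    obtain ⟨k, hk, hkn⟩ := h'
    exact ⟨k, Nat.lt_succ_iff.1 (by exact_mod_cast hkn), hk⟩
  · rintro ⟨k, hkn, hk⟩
    exact (iInf₂_le k hk).trans (by exact_mod_cast hkn)

theorem globalGorensteinProjectiveDimension_lt_top_iff :
    globalGorensteinProjectiveDimension C 𝒳 𝒴 < ⊤ ↔ ∃ n : ℕ, ∀ M : C, ∃ k ≤ n,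
      IsResolvedBy (gorensteinProjective 𝒳 𝒴) k M := by
  have key : ∀ (M : C) (k : ℕ), HasResolutionOfLength (gorensteinProjective 𝒳 𝒴) M k ↔
      IsResolvedBy (gorensteinProjective 𝒳 𝒴) k M := fun M k =>
    ⟨fun h => h.isResolvedBy fun _ _ e h => gorensteinProjective_of_iso h e,
      fun h => h.hasResolutionOfLength⟩
  simp only [← key, ← resolutionDimension_le_iff]
  constructor
  · intro h
    obtain ⟨n, hn⟩ := ENat.ne_top_iff_exists.1 h.ne
    exact ⟨n, fun M => (le_iSup (gorensteinProjectiveDimension 𝒳 𝒴) M).trans hn.ge⟩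
  · rintro ⟨n, hn⟩
    exact (iSup_le hn).trans_lt (ENat.natCast_lt_top n)

/-- Suppose that `𝒳` is the class of projective objects and is contained in `𝒴`. The global
`(𝒳, 𝒴)`-Gorenstein projective dimension is finite if and only if the objects of `𝒴` have bounded
injective dimension and the injective objects have bounded projective dimension. -/
theorem globalGorensteinProjectiveDimension_lt_top_iff_classDimension [HasExt.{w} C]
    [EnoughProjectives C] [EnoughInjectives C] {ℐ : ObjectProperty C}
    (h𝒳 : ∀ M, 𝒳 M ↔ Projective M) (h𝒴 : ∀ M, Projective M → 𝒴 M) (hℐ : ∀ M, ℐ M ↔ Injective M) :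
    (classInjectiveDimension 𝒴 < ⊤ ∧ classProjectiveDimension ℐ < ⊤) ↔
      globalGorensteinProjectiveDimension C 𝒳 𝒴 < ⊤ := by
  rw [classInjectiveDimension_lt_top_iff, classProjectiveDimension_lt_top_iff,
    globalGorensteinProjectiveDimension_lt_top_iff]
  constructor
  · rintro ⟨⟨m, hm⟩, ⟨n, hn⟩⟩
    refine ⟨max m n, fun M => ⟨max m n, le_rfl, ?_⟩⟩
    obtain ⟨K, hK⟩ := exists_isSyzygy (max m n) M
    refine hK.isResolvedBy (fun P _ => gorensteinProjective_of_projective (fun M => (h𝒳 M).2) P)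
      (fun _ _ e h => gorensteinProjective_of_iso h e)
      (hK.gorensteinProjective (fun M => (h𝒳 M).2) (fun Y hY => ?_) fun I hI => ?_)
    · have := hm Y hY
      exact hasInjectiveDimensionLT_of_ge Y (m + 1) _ (by omega)
    · have := hn I ((hℐ I).2 hI)
      exact hasProjectiveDimensionLT_of_ge I (n + 1) _ (by omega)
  · rintro ⟨n, hn⟩
    refine ⟨⟨n, fun Y hY => ?_⟩, ⟨n, fun I hI => ?_⟩⟩
    · refine HasInjectiveDimensionLT.mk fun i hi M e => ?_
      obtain ⟨k, hk, hM⟩ := hn M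
      have := hM.subsingleton_ext
        (fun G hG => (isGorensteinClass_gorensteinProjective (fun M => (h𝒳 M).1) G hG).1) hY i
        (by omega)
      exact Subsingleton.elim _ _
    · obtain ⟨k, hk, hM⟩ := hn I
      obtain ⟨L, G, hL, -, ⟨f, g, w, hS⟩⟩ := hM.exists_isExtension h𝒳 h𝒴
      -- Injectivity of `I` splits `f`, making `I` a retract of `L`.
      have hI' : Injective I := (hℐ I).1 hI
      have hf : Mono f := hS.mono_f
      have := Retract.hasProjectiveDimensionLT
        ⟨f, Injective.factorThru (𝟙 I) f, Injective.comp_factorThru (𝟙 I) f⟩ (k + 1)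
      exact hasProjectiveDimensionLT_of_ge I (k + 1) _ (by omega)

end GlobalDimension

end RelGorenstein

end

theorem proposition3p10 (R : Type u) [Ring R] :
    (RelGorenstein.classInjectiveDimension (RelGorenstein.flatClass R) < ⊤ ∧
      RelGorenstein.classProjectiveDimension (RelGorenstein.injClass R) < ⊤) ↔
    RelGorenstein.globalDingProjectiveDimension R < ⊤ := by
  refine RelGorenstein.globalGorensteinProjectiveDimension_lt_top_iff_classDimension
    (fun M => IsProjective.iff_projective M) (fun M hM => ?_)
    (fun M => Module.injective_iff_injective_object R M)
  have : Module.Projective R M := (IsProjective.iff_projective M).2 hM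
  exact RelGorenstein.isFlatModule_of_projective M
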